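/- All graphs are finite, simple and undirected. The total graph $\mathcal T(G)$ of a graph $G$ is the graph whose vertex set is the disjoint union of the vertex set and the edge set of $G$, where two distinct elements are adjacent if and only if they are two adjacent vertices of $G$, two edges of $G$ with a common end vertex, or a vertex and an edge of $G$ incident to it. Put $\mathcal T^0(G)=G$ and $\mathcal T^k(G)=\mathcal T(\mathcal T^{k-1}(G))$ for $k\ge 1$. Two graphs are cospectral if their adjacency matrices have the same eigenvalues with the same multiplicities. Theorem. Let $G_1$ and $G_2$ be two regular graphs of the same order $n_0$ and the same degree $r_0\ge 3$. Then, for every $k\ge 1$, the following hold. (a) $\mathcal T^k(G_1)$ and $\mathcal T^k(G_2)$ have the same order and the same number of edges. (b) $\mathcal T^k(G_1)$ and $\mathcal T^k(G_2)$ are cospectral if and only if $G_1$ and $G_2$ are cospectral. -/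

import Mathlib

universe u v

namespace SimpleGraph

/-- The total graph of `G`: its vertices are the vertices and the edges of `G`, and two of them are
adjacent iff they are adjacent vertices, distinct edges with a common end, or a vertex and an edge
incident to it. -/
def totalGraph {V : Type u} (G : SimpleGraph V) : SimpleGraph (V ⊕ G.edgeSet) where
  Adj
    | Sum.inl a, Sum.inl b => G.Adj a b
    | Sum.inl a, Sum.inr e => a ∈ (e : Sym2 V)
    | Sum.inr e, Sum.inl a => a ∈ (e : Sym2 V)
    | Sum.inr e, Sum.inr f => G.lineGraph.Adj e f
  symm := ⟨by
    rintro (a | e) (b | f) h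
    · exact G.adj_symm h
    · exact h
    · exact h
    · exact G.lineGraph.adj_symm h⟩
  loopless := ⟨by
    rintro (a | e) h
    · exact G.irrefl h
    · exact G.lineGraph.irrefl h⟩

/-- The `k`-th iterated total graph of `G`, together with its vertex type:
the `0`-th one is `G`, and the `(k+1)`-st one is the total graph of the `k`-th one. -/
def iterTotalAux {V : Type u} (G : SimpleGraph V) : ℕ → (W : Type u) × SimpleGraph W
  | 0 => ⟨V, G⟩
  | k + 1 => ⟨(iterTotalAux G k).1 ⊕ (iterTotalAux G k).2.edgeSet, (iterTotalAux G k).2.totalGraph⟩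

/-- The vertex type of the `k`-th iterated total graph of `G`. -/
def IterTotalVertex {V : Type u} (G : SimpleGraph V) (k : ℕ) : Type u :=
  (iterTotalAux G k).1

/-- The `k`-th iterated total graph of `G`. -/
def iterTotalGraph {V : Type u} (G : SimpleGraph V) (k : ℕ) : SimpleGraph (IterTotalVertex G k) :=
  (iterTotalAux G k).2

instance IterTotalVertex.instFinite {V : Type u} [Finite V] (G : SimpleGraph V) (k : ℕ) :
    Finite (IterTotalVertex G k) := by
  induction k with
  | zero => exact inferInstanceAs (Finite V)
  | succ k ih =>
    have h : Finite (iterTotalAux G k).1 := ih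
    exact inferInstanceAs (Finite ((iterTotalAux G k).1 ⊕ (iterTotalAux G k).2.edgeSet))

open Classical in
/-- The adjacency spectrum of a finite graph: the multiset of the eigenvalues of its adjacency
matrix, each repeated according to its multiplicity. -/
noncomputable def adjSpectrum {V : Type u} [Finite V] (G : SimpleGraph V) : Multiset ℝ :=
  letI : Fintype V := Fintype.ofFinite V
  (G.adjMatrix ℝ).charpoly.roots

/-- Two finite graphs are cospectral if they have the same adjacency spectrum. -/
def Cospectral {V : Type u} {W : Type v} [Finite V] [Finite W]
    (G : SimpleGraph V) (H : SimpleGraph W) : Prop :=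
  G.adjSpectrum = H.adjSpectrum

end SimpleGraph

/-! Let `G` be `r`-regular with adjacency matrix `A` and vertex-edge incidence matrix `R`. Then `R
Rᵀ = A + r` and `Rᵀ R` is the line graph's matrix plus `2`, so block elimination reduces the total
graph's characteristic polynomial to a polynomial in `A`. Up to copies of `-2`, whose number depends
only on the order and `r`, each eigenvalue `t` of `G` yields the two roots of `(x + 2)(x - t) - (t +
r)(1 + x - t)`. Conversely, for `r ≥ 3` the lower root strictly increases with `t ≥ -r`, so the
least element of the union comes from the least `t`; removing both of its roots and repeating
recovers the spectrum (`Multiset.eq_of_map_add_map_eq`). Total graphs are `2r`-regular, so the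
equivalence iterates. -/

open Matrix Polynomial

/-! ### Recovering a multiset from two images -/

/-- A multiset `S` of reals `≥ a` can be recovered from the union of its images under two functions
`f ≤ g` on `[a, ∞)`, the smaller of which is strictly increasing. -/
theorem Multiset.eq_of_map_add_map_eq {a : ℝ} {f g : ℝ → ℝ}
    (hf : StrictMonoOn f (Set.Ici a)) (hfg : ∀ x ∈ Set.Ici a, f x ≤ g x) {S T : Multiset ℝ}
    (hS : ∀ x ∈ S, a ≤ x) (hT : ∀ x ∈ T, a ≤ x)
    (h : S.map f + S.map g = T.map f + T.map g) : S = T := by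
  have least : ∀ U : Multiset ℝ, U ≠ 0 → ∃ x ∈ U, ∀ y ∈ U, x ≤ y := by
    intro U hU
    obtain ⟨z, hz⟩ := Multiset.exists_mem_of_ne_zero hU
    obtain ⟨x, hx, hmin⟩ := U.toFinset.exists_min_image id ⟨z, by simpa using hz⟩
    exact ⟨x, by simpa using hx, fun y hy => hmin y (by simpa using hy)⟩
  have mem_ge : ∀ U : Multiset ℝ, (∀ y ∈ U, a ≤ y) → ∀ x, a ≤ x → (∀ y ∈ U, x ≤ y) →
      ∀ z ∈ U.map f + U.map g, f x ≤ z := by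
    intro U hU x hx hmin z hz
    rcases Multiset.mem_add.1 hz with hz | hz <;> obtain ⟨y, hy, rfl⟩ := Multiset.mem_map.1 hz
    · exact hf.monotoneOn hx (hU y hy) (hmin y hy)
    · exact (hf.monotoneOn hx (hU y hy) (hmin y hy)).trans (hfg y (hU y hy))
  induction hc : S.card generalizing S T with
  | zero =>
    have h1 := congrArg Multiset.card h
    simp only [Multiset.card_add, Multiset.card_map] at h1
    rw [Multiset.card_eq_zero.1 hc, eq_comm, ← Multiset.card_eq_zero]
    omega
  | succ n ih =>
    have h1 := congrArg Multiset.card h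
    simp only [Multiset.card_add, Multiset.card_map] at h1
    obtain ⟨x, hx, hxmin⟩ := least S (by rintro rfl; simp at hc)
    obtain ⟨y, hy, hymin⟩ := least T (by rintro rfl; rw [hc] at h1; simp at h1)
    -- `f x` and `f y` are both the minimum of the same union.
    have hxy : x = y := by
      refine hf.injOn (hS x hx) (hT y hy) (le_antisymm ?_ ?_)
      · refine mem_ge S hS x (hS x hx) hxmin _ ?_
        rw [h]
        exact Multiset.mem_add.2 (Or.inl (Multiset.mem_map_of_mem f hy))
      · refine mem_ge T hT y (hT y hy) hymin _ ?_
        rw [← h]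
        exact Multiset.mem_add.2 (Or.inl (Multiset.mem_map_of_mem f hx))
    subst hxy
    obtain ⟨S', rfl⟩ := Multiset.exists_cons_of_mem hx
    obtain ⟨T', rfl⟩ := Multiset.exists_cons_of_mem hy
    congr 1
    refine ih (fun z hz => hS z (Multiset.mem_cons_of_mem hz))
      (fun z hz => hT z (Multiset.mem_cons_of_mem hz)) ?_ (by simpa using hc)
    simpa [Multiset.cons_add, Multiset.add_cons] using h

/-! ### Determinants -/

/-- The determinant of the block matrix `[x - A, -R; -Rᵀ, x + 2 - Rᵀ R]` for `R Rᵀ = A + r`. -/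
theorem Matrix.pow_mul_det_fromBlocks {V E : Type*} [Fintype V] [Fintype E] [DecidableEq V]
    [DecidableEq E] (A : Matrix V V ℝ) (R : Matrix V E ℝ) (r x : ℝ) (hR : R * Rᵀ = A + r • 1) :
    (x + 2) ^ Fintype.card V *
        (fromBlocks (x • 1 - A) (-R) (-Rᵀ) ((x + 2) • 1 - Rᵀ * R)).det =
      (x + 2) ^ Fintype.card E *
        ((x + 2) • (x • 1 - A) - (A + r • 1) * ((1 + x) • 1 - A)).det := by
  -- The inner factor clears `Rᵀ R` from the lower right block, the outer one then clears the upper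
  -- right. Using `x + 2` rather than its inverse keeps `x = -2` allowed.
  have key : fromBlocks ((x + 2) • 1) R 0 1 * (fromBlocks 1 0 (-Rᵀ) 1 *
      fromBlocks (x • 1 - A) (-R) (-Rᵀ) ((x + 2) • 1 - Rᵀ * R)) =
      fromBlocks ((x + 2) • (x • 1 - A) - (A + r • 1) * ((1 + x) • 1 - A)) 0
        (-(Rᵀ * ((1 + x) • 1 - A))) ((x + 2) • (1 : Matrix E E ℝ)) := by
    rw [fromBlocks_multiply, fromBlocks_multiply, ← hR]
    congr 1
    all_goals
      simp only [Matrix.one_mul, Matrix.zero_mul, Matrix.mul_zero, Matrix.mul_one, Matrix.smul_mul,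
        Matrix.mul_smul, Matrix.mul_sub, Matrix.mul_add, Matrix.mul_neg, Matrix.neg_mul,
        Matrix.mul_assoc]
      module
  have h := congrArg det key
  rw [det_mul, det_mul, det_fromBlocks_zero₂₁, det_fromBlocks_zero₁₂, det_fromBlocks_zero₁₂] at h
  simpa [det_smul, mul_comm] using h

/-- The determinant of a polynomial in a real symmetric matrix. -/
theorem Matrix.IsHermitian.det_aeval {V : Type*} [Fintype V] [DecidableEq V]
    {A : Matrix V V ℝ} (hA : A.IsHermitian) (p : ℝ[X]) :
    (aeval A p).det = ∏ i, p.eval (hA.eigenvalues i) := by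
  have h : aeval A p = Unitary.conjStarAlgAut ℝ _ hA.eigenvectorUnitary
      (aeval (diagonal hA.eigenvalues) p) := by
    conv_lhs => rw [hA.spectral_theorem]
    exact aeval_algHom_apply (Unitary.conjStarAlgAut ℝ _ hA.eigenvectorUnitary).toAlgEquiv _ p
  have hd : aeval (diagonal hA.eigenvalues) p = diagonal fun i => p.eval (hA.eigenvalues i) := by
    have := aeval_algHom_apply (Matrix.diagonalAlgHom ℝ (n := V) (α := ℝ)) hA.eigenvalues p
    rw [Matrix.diagonalAlgHom_apply] at this
    rw [this, Matrix.diagonalAlgHom_apply]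
    congr 1
    ext i
    simp [Polynomial.aeval_def, Polynomial.eval₂_eq_sum_range, Polynomial.eval_eq_sum_range]
  rw [h, hd, Unitary.conjStarAlgAut_apply, det_mul_right_comm]
  simp

namespace SimpleGraph

theorem sum_edgeSet_eq_sum {V : Type*} [Fintype V] (G : SimpleGraph V) [DecidableRel G.Adj]
    (f : Sym2 V → ℝ) (hf : ∀ e ∉ G.edgeSet, f e = 0) :
    ∑ e : G.edgeSet, f e = ∑ e, f e := by
  rw [← Finset.sum_subset (Finset.subset_univ G.edgeFinset)
    (fun e _ he => hf e (by simpa using he))]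
  exact (Finset.sum_subtype G.edgeFinset (by simp) f).symm

/-! ### Incidence matrix and regularity -/

section Incidence

variable {V : Type*} [DecidableEq V] (G : SimpleGraph V)

/-- The vertex-edge incidence matrix of `G`, with columns indexed by the edges only. -/
def edgeIncMatrix : Matrix V G.edgeSet ℝ :=
  of fun v e => if v ∈ (e : Sym2 V) then 1 else 0

theorem edgeIncMatrix_apply (v : V) (e : G.edgeSet) :
    G.edgeIncMatrix v e = if v ∈ (e : Sym2 V) then 1 else 0 := rfl

theorem adjMatrix_totalGraph [DecidableRel G.Adj] [DecidableRel G.lineGraph.Adj]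
    [DecidableRel G.totalGraph.Adj] :
    G.totalGraph.adjMatrix ℝ =
      fromBlocks (G.adjMatrix ℝ) G.edgeIncMatrix G.edgeIncMatrixᵀ (G.lineGraph.adjMatrix ℝ) := by
  ext (v | e) (w | f) <;>
    simp only [adjMatrix_apply, fromBlocks_apply₁₁, fromBlocks_apply₁₂, fromBlocks_apply₂₁,
      fromBlocks_apply₂₂, transpose_apply, edgeIncMatrix_apply] <;>
    exact if_congr Iff.rfl rfl rfl

theorem edgeIncMatrix_eq [DecidableRel G.Adj] (v : V) (e : G.edgeSet) :
    G.edgeIncMatrix v e = G.incMatrix ℝ v e := by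
  rw [edgeIncMatrix_apply, incMatrix_apply']
  simp [incidenceSet, e.2]

variable [Fintype V] [DecidableRel G.Adj]

theorem sum_edgeIncMatrix_row (v : V) : ∑ e, G.edgeIncMatrix v e = G.degree v := by
  simp_rw [edgeIncMatrix_eq]
  rw [G.sum_edgeSet_eq_sum (fun e => G.incMatrix ℝ v e)
    (fun e he => G.incMatrix_of_notMem_incidenceSet (fun h => he h.1)), sum_incMatrix_apply]

theorem sum_edgeIncMatrix_col (e : G.edgeSet) : ∑ v, G.edgeIncMatrix v e = 2 := by
  simp_rw [edgeIncMatrix_eq]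
  exact G.sum_incMatrix_apply_of_mem_edgeSet e.2

theorem edgeIncMatrix_mul_transpose {r : ℕ} (hG : G.IsRegularOfDegree r) :
    G.edgeIncMatrix * G.edgeIncMatrixᵀ = G.adjMatrix ℝ + (r : ℝ) • 1 := by
  ext v w
  have h := congrFun (congrFun (G.incMatrix_mul_transpose (R := ℝ)) v) w
  rw [mul_apply] at h ⊢
  simp_rw [transpose_apply, edgeIncMatrix_eq] at h ⊢
  rw [G.sum_edgeSet_eq_sum (fun e => G.incMatrix ℝ v e * G.incMatrix ℝ w e)
    (fun e he => by rw [G.incMatrix_of_notMem_incidenceSet (fun h => he h.1), zero_mul]), h]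
  by_cases hvw : v = w
  · subst hvw
    simp [hG v]
  · simp [hvw, adjMatrix_apply]

theorem edgeIncMatrix_transpose_mul [DecidableRel G.lineGraph.Adj] :
    G.edgeIncMatrixᵀ * G.edgeIncMatrix = G.lineGraph.adjMatrix ℝ + (2 : ℝ) • 1 := by
  ext e f
  rw [mul_apply]
  by_cases hef : e = f
  · subst hef
    simp only [transpose_apply, Matrix.add_apply, adjMatrix_apply, SimpleGraph.irrefl, if_false,
      Matrix.smul_apply, one_apply_eq, smul_eq_mul, mul_one, zero_add]
    rw [← G.sum_edgeIncMatrix_col e]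
    exact Finset.sum_congr rfl fun v _ => by simp [edgeIncMatrix_apply]
  · simp only [transpose_apply, Matrix.add_apply, adjMatrix_apply, Matrix.smul_apply, one_apply_ne hef,
      smul_zero, add_zero, edgeIncMatrix_apply, lineGraph_adj_iff_exists, ← ite_and, ne_eq,
      hef, not_false_eq_true, true_and, mul_ite, mul_one, mul_zero]
    split_ifs with h
    · obtain ⟨v, hve, hvf⟩ := h
      rw [Finset.sum_eq_single v]
      · simp [hve, hvf]
      · intro w _ hw
        rw [if_neg]
        rintro ⟨hwf, hwe⟩
        exact hef (Subtype.ext (((Sym2.mem_and_mem_iff hw).1 ⟨hwe, hve⟩).trans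
          ((Sym2.mem_and_mem_iff hw).1 ⟨hwf, hvf⟩).symm))
      · simp
    · exact Finset.sum_eq_zero fun v _ => if_neg fun hv => h ⟨v, hv.2, hv.1⟩

variable {G} {r : ℕ}

/-- `A + r = R Rᵀ` is positive semidefinite. -/
theorem IsRegularOfDegree.neg_le_eigenvalues
    (hG : G.IsRegularOfDegree r) (i : V) : -(r : ℝ) ≤ (G.isHermitian_adjMatrix ℝ).eigenvalues i := by
  have hp := posSemidef_self_mul_conjTranspose G.edgeIncMatrix
  rw [conjTranspose_eq_transpose_of_trivial, G.edgeIncMatrix_mul_transpose hG] at hp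
  have hs := (G.isHermitian_adjMatrix ℝ).eigenvalues_mem_spectrum_real i
  have hs' : (G.isHermitian_adjMatrix ℝ).eigenvalues i + r ∈
      spectrum ℝ (G.adjMatrix ℝ + (r : ℝ) • 1) := by
    have := (spectrum.add_mem_add_iff (s := (r : ℝ))).2 hs
    rwa [Algebra.algebraMap_eq_smul_one, add_comm (_ • _)] at this
  rw [hp.isHermitian.spectrum_real_eq_range_eigenvalues] at hs'
  obtain ⟨j, hj⟩ := hs'
  linarith [hp.eigenvalues_nonneg j]

/-- The total graph of an `r`-regular graph is `2r`-regular. -/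
theorem IsRegularOfDegree.totalGraph [DecidableRel G.totalGraph.Adj]
    (hG : G.IsRegularOfDegree r) :
    G.totalGraph.IsRegularOfDegree (2 * r) := by
  classical
  have hrow : ∀ v, ∑ w, G.adjMatrix ℝ v w = r := fun v => by
    simp [adjMatrix_apply, ← hG v, card_neighborFinset_eq_degree, ← neighborFinset_eq_filter]
  intro x
  have hx : (G.totalGraph.degree x : ℝ) = ∑ y, G.totalGraph.adjMatrix ℝ x y := by
    simp [adjMatrix_apply, ← neighborFinset_eq_filter]
  rw [adjMatrix_totalGraph, Fintype.sum_sum_type] at hx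
  rcases x with v | e
  · simp only [fromBlocks_apply₁₁, fromBlocks_apply₁₂, hrow, sum_edgeIncMatrix_row, hG v] at hx
    exact_mod_cast hx.trans (two_mul _).symm
  -- Row sums of `Rᵀ R` are `2r`; the diagonal contributes `2`.
  · have hline : ∑ f, G.lineGraph.adjMatrix ℝ e f = 2 * r - 2 := by
      have h : ∑ f, (G.edgeIncMatrixᵀ * G.edgeIncMatrix) e f = 2 * r := by
        simp_rw [mul_apply]
        rw [Finset.sum_comm]
        simp_rw [← Finset.mul_sum, sum_edgeIncMatrix_row, hG.degree_eq, transpose_apply,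
          ← Finset.sum_mul, sum_edgeIncMatrix_col]
      rw [edgeIncMatrix_transpose_mul] at h
      simp only [Matrix.add_apply, Finset.sum_add_distrib, Matrix.smul_apply, one_apply, smul_eq_mul, mul_ite,
        mul_one, mul_zero, Finset.sum_ite_eq, Finset.mem_univ, if_true] at h
      linarith
    simp only [fromBlocks_apply₂₁, fromBlocks_apply₂₂, transpose_apply, hline,
      sum_edgeIncMatrix_col] at hx
    have : (G.totalGraph.degree (Sum.inr e) : ℝ) = 2 * r := by rw [hx]; ring
    exact_mod_cast this

end Incidence

/-! ### The two roots -/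

/-- The larger of the two eigenvalues of the total graph of an `r`-regular graph `G` that come from
the eigenvalue `t` of `G`. -/
noncomputable def totalRootUpper (r t : ℝ) : ℝ := t + (r - 2) / 2 + √(4 * t + r ^ 2 + 4) / 2

/-- The smaller of the two eigenvalues of the total graph of an `r`-regular graph `G` that come from
the eigenvalue `t` of `G`. -/
noncomputable def totalRootLower (r t : ℝ) : ℝ := t + (r - 2) / 2 - √(4 * t + r ^ 2 + 4) / 2

theorem totalRootLower_le_upper (r t : ℝ) : totalRootLower r t ≤ totalRootUpper r t := by
  have := Real.sqrt_nonneg (4 * t + r ^ 2 + 4)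
  unfold totalRootLower totalRootUpper
  linarith

/-- On `t ≥ -r` the radicand is at least `(r - 2) ^ 2 ≥ 1`, which is where `r ≥ 3` enters. Two such
square roots `a < b` have `a + b > 2`, so half their difference is less than the increase in `t`. -/
theorem strictMonoOn_totalRootLower {r : ℝ} (hr : 3 ≤ r) :
    StrictMonoOn (totalRootLower r) (Set.Ici (-r)) := by
  intro s hs t ht hst
  have hs' : -r ≤ s := hs
  have h1 : 1 ≤ √(4 * s + r ^ 2 + 4) := Real.one_le_sqrt.2 (by nlinarith)
  have h2 := Real.sqrt_lt_sqrt (show 0 ≤ 4 * s + r ^ 2 + 4 by nlinarith)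
    (show 4 * s + r ^ 2 + 4 < 4 * t + r ^ 2 + 4 by linarith)
  have h3 := Real.sq_sqrt (show 0 ≤ 4 * s + r ^ 2 + 4 by nlinarith)
  have h4 := Real.sq_sqrt (show 0 ≤ 4 * t + r ^ 2 + 4 by nlinarith)
  unfold totalRootLower
  nlinarith

theorem totalRoot_mul (r t x : ℝ) (ht : -r ≤ t) :
    (x - totalRootLower r t) * (x - totalRootUpper r t) =
      (x + 2) * (x - t) - (t + r) * (1 + x - t) := by
  have h := Real.sq_sqrt (show 0 ≤ 4 * t + r ^ 2 + 4 by nlinarith [sq_nonneg (r - 2)])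
  unfold totalRootLower totalRootUpper
  linear_combination (-1 / 4) * h

/-! ### Spectrum of the total graph -/

section Spectrum

variable {V : Type*} [Fintype V] [DecidableEq V] {G : SimpleGraph V} [DecidableRel G.Adj]

theorem adjSpectrum_eq_roots : G.adjSpectrum = (G.adjMatrix ℝ).charpoly.roots := by
  unfold adjSpectrum
  congr!

theorem adjSpectrum_eq_map_eigenvalues :
    G.adjSpectrum = Finset.univ.val.map (G.isHermitian_adjMatrix ℝ).eigenvalues := by
  rw [adjSpectrum_eq_roots, (G.isHermitian_adjMatrix ℝ).roots_charpoly_eq_eigenvalues]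
  rfl

theorem IsRegularOfDegree.neg_le_of_mem_adjSpectrum {r : ℕ} (hG : G.IsRegularOfDegree r) :
    ∀ t ∈ G.adjSpectrum, -(r : ℝ) ≤ t := by
  intro t ht
  rw [adjSpectrum_eq_map_eigenvalues] at ht
  obtain ⟨i, -, rfl⟩ := Multiset.mem_map.1 ht
  exact hG.neg_le_eigenvalues i

/-- The characteristic polynomial of the total graph of a regular graph. -/
theorem IsRegularOfDegree.charpoly_totalGraph [DecidableRel G.totalGraph.Adj] {r : ℕ}
    (hG : G.IsRegularOfDegree r) :
    (X - C (-2)) ^ Fintype.card V * (G.totalGraph.adjMatrix ℝ).charpoly =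
      (X - C (-2)) ^ Fintype.card G.edgeSet *
        ∏ i, ((X - C (totalRootLower r ((G.isHermitian_adjMatrix ℝ).eigenvalues i))) *
          (X - C (totalRootUpper r ((G.isHermitian_adjMatrix ℝ).eigenvalues i)))) := by
  classical
  refine Polynomial.funext fun x => ?_
  have h := Matrix.pow_mul_det_fromBlocks (G.adjMatrix ℝ) G.edgeIncMatrix r x
    (G.edgeIncMatrix_mul_transpose hG)
  have hblock : scalar (V ⊕ G.edgeSet) x - G.totalGraph.adjMatrix ℝ =
      fromBlocks (x • 1 - G.adjMatrix ℝ) (-G.edgeIncMatrix) (-G.edgeIncMatrixᵀ)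
        ((x + 2) • 1 - G.edgeIncMatrixᵀ * G.edgeIncMatrix) := by
    rw [adjMatrix_totalGraph, edgeIncMatrix_transpose_mul, scalar_apply, ← smul_one_eq_diagonal,
      ← fromBlocks_one, fromBlocks_smul, sub_eq_add_neg, fromBlocks_neg, fromBlocks_add]
    congr 1
    · rw [smul_zero, zero_add]
    · rw [smul_zero, zero_add]
    · module
  -- As a polynomial in `A`, its determinant is a product over the eigenvalues.
  have hpoly : (x + 2) • (x • 1 - G.adjMatrix ℝ) -
      (G.adjMatrix ℝ + (r : ℝ) • 1) * ((1 + x) • 1 - G.adjMatrix ℝ) =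
      aeval (G.adjMatrix ℝ)
        (C (x + 2) * (C x - X) - (X + C (r : ℝ)) * (C (1 + x) - X)) := by
    simp only [map_sub, map_mul, map_add, aeval_C, aeval_X, Algebra.algebraMap_eq_smul_one]
    simp only [add_smul, ← Algebra.algebraMap_eq_smul_one]
    simp [Algebra.smul_def, add_mul]
  rw [hpoly, (G.isHermitian_adjMatrix ℝ).det_aeval] at h
  simp only [eval_mul, eval_pow, eval_sub, eval_X, eval_C, sub_neg_eq_add, eval_prod,
    eval_charpoly, hblock, totalRoot_mul _ _ _ (hG.neg_le_eigenvalues _)]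
  simpa using h

/-- Copies of `-2` stand on both sides because there may be fewer edges than vertices when `r` is
small. -/
theorem IsRegularOfDegree.adjSpectrum_totalGraph {r : ℕ} (hG : G.IsRegularOfDegree r) :
    Fintype.card V • {-2} + G.totalGraph.adjSpectrum =
      Fintype.card G.edgeSet • {-2} +
        (G.adjSpectrum.map (totalRootLower r) + G.adjSpectrum.map (totalRootUpper r)) := by
  classical
  have h := congrArg Polynomial.roots hG.charpoly_totalGraph
  have hprod : ∏ i, ((X - C (totalRootLower r ((G.isHermitian_adjMatrix ℝ).eigenvalues i))) *
      (X - C (totalRootUpper r ((G.isHermitian_adjMatrix ℝ).eigenvalues i)))) ≠ 0 :=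
    Finset.prod_ne_zero_iff.2 fun i _ => mul_ne_zero (X_sub_C_ne_zero _) (X_sub_C_ne_zero _)
  rw [roots_mul (mul_ne_zero (pow_ne_zero _ (X_sub_C_ne_zero _)) (charpoly_monic _).ne_zero),
    roots_mul (mul_ne_zero (pow_ne_zero _ (X_sub_C_ne_zero _)) hprod),
    Finset.prod_mul_distrib] at h
  rw [Finset.prod_mul_distrib] at hprod
  rw [roots_mul hprod, roots_pow, roots_pow, roots_X_sub_C,
    roots_prod _ _ (left_ne_zero_of_mul hprod), roots_prod _ _ (right_ne_zero_of_mul hprod)] at h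
  simp only [roots_X_sub_C, Multiset.bind_singleton] at h
  rw [adjSpectrum_eq_roots, adjSpectrum_eq_map_eigenvalues, Multiset.map_map, Multiset.map_map]
  exact h

end Spectrum

theorem IsRegularOfDegree.two_mul_card_edgeSet {V : Type*} [Fintype V] {G : SimpleGraph V}
    [DecidableRel G.Adj] {r : ℕ} (hG : G.IsRegularOfDegree r) :
    2 * Fintype.card G.edgeSet = Fintype.card V * r := by
  rw [← edgeFinset_card, ← sum_degrees_eq_twice_card_edges, Finset.sum_congr rfl fun v _ => hG v]
  simp

section Pair

variable {V : Type u} {W : Type v} [Fintype V] [Fintype W] {G : SimpleGraph V} {H : SimpleGraph W}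
  [DecidableRel G.Adj] [DecidableRel H.Adj] {r : ℕ}

theorem IsRegularOfDegree.card_edgeSet_eq (hG : G.IsRegularOfDegree r)
    (hH : H.IsRegularOfDegree r) (hc : Nat.card V = Nat.card W) :
    Nat.card G.edgeSet = Nat.card H.edgeSet := by
  classical
  have h1 := hG.two_mul_card_edgeSet
  have h2 := hH.two_mul_card_edgeSet
  simp only [Nat.card_eq_fintype_card] at hc ⊢
  rw [hc] at h1
  omega

/-- For regular graphs of the same order and the same degree `r ≥ 3`, the total graphs are
cospectral iff the graphs are. -/
theorem IsRegularOfDegree.cospectral_totalGraph_iff (hr : 3 ≤ r) (hG : G.IsRegularOfDegree r)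
    (hH : H.IsRegularOfDegree r) (hc : Nat.card V = Nat.card W) :
    G.totalGraph.Cospectral H.totalGraph ↔ G.Cospectral H := by
  classical
  have he := hG.card_edgeSet_eq hH hc
  have h1 := hG.adjSpectrum_totalGraph
  have h2 := hH.adjSpectrum_totalGraph
  simp only [Nat.card_eq_fintype_card] at hc he
  rw [hc, he] at h1
  unfold Cospectral
  constructor
  · intro h
    rw [h, h2] at h1
    exact (Multiset.eq_of_map_add_map_eq (strictMonoOn_totalRootLower (by exact_mod_cast hr))
      (fun x _ => totalRootLower_le_upper _ x)
      hH.neg_le_of_mem_adjSpectrum hG.neg_le_of_mem_adjSpectrum (add_left_cancel h1)).symm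
  · intro h
    rw [h, ← h2] at h1
    exact add_left_cancel h1

end Pair

/-! ### Iteration -/

/-- The `k`-th iterated total graph of an `r`-regular graph is `2 ^ k * r`-regular. -/
theorem IsRegularOfDegree.iterTotalGraph {V : Type u} [Finite V] {G : SimpleGraph V}
    [G.LocallyFinite] {r : ℕ} (hG : G.IsRegularOfDegree r) (k : ℕ)
    [i : (G.iterTotalGraph k).LocallyFinite] :
    (G.iterTotalGraph k).IsRegularOfDegree (2 ^ k * r) := by
  classical
  -- `LocallyFinite` carries data, so instances met in the recursion need not agree definitionally.
  have inst_irrel : ∀ {W : Type u} {H : SimpleGraph W} {d : ℕ} {i j : H.LocallyFinite},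
      @IsRegularOfDegree W H i d → @IsRegularOfDegree W H j d := by
    intro W H d i j h
    convert h
  induction k generalizing i with
  | zero =>
    rw [pow_zero, one_mul]
    exact inst_irrel hG
  | succ k ih =>
    let _ := Fintype.ofFinite (G.IterTotalVertex k)
    rw [pow_succ', mul_assoc]
    have h := IsRegularOfDegree.totalGraph (G := G.iterTotalGraph k) ih
    exact inst_irrel h

/-- Iterated total graphs of regular graphs of the same order and degree `r ≥ 3` have the same
order, and they are cospectral iff the graphs are. -/
theorem IsRegularOfDegree.card_eq_and_cospectral_iterTotalGraph_iff {V₁ : Type u} {V₂ : Type v}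
    [Finite V₁] [Finite V₂] {G₁ : SimpleGraph V₁} {G₂ : SimpleGraph V₂} {r : ℕ} (hr : 3 ≤ r)
    [G₁.LocallyFinite] [G₂.LocallyFinite]
    (hG₁ : G₁.IsRegularOfDegree r) (hG₂ : G₂.IsRegularOfDegree r)
    (hc : Nat.card V₁ = Nat.card V₂) (k : ℕ) :
    Nat.card (G₁.IterTotalVertex k) = Nat.card (G₂.IterTotalVertex k) ∧
      ((G₁.iterTotalGraph k).Cospectral (G₂.iterTotalGraph k) ↔ G₁.Cospectral G₂) := by
  classical
  induction k with
  | zero => exact ⟨hc, Iff.rfl⟩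
  | succ k ih =>
    obtain ⟨hk, hiff⟩ := ih
    let _ := Fintype.ofFinite (G₁.IterTotalVertex k)
    let _ := Fintype.ofFinite (G₂.IterTotalVertex k)
    have hle : 3 ≤ 2 ^ k * r := hr.trans (Nat.le_mul_of_pos_left r (by positivity))
    have hcard : Nat.card (G₁.IterTotalVertex k ⊕ (G₁.iterTotalGraph k).edgeSet) =
        Nat.card (G₂.IterTotalVertex k ⊕ (G₂.iterTotalGraph k).edgeSet) := by
      rw [Nat.card_sum, Nat.card_sum, hk,
        IsRegularOfDegree.card_edgeSet_eq (hG₁.iterTotalGraph k) (hG₂.iterTotalGraph k) hk]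
    exact ⟨hcard, (IsRegularOfDegree.cospectral_totalGraph_iff hle (hG₁.iterTotalGraph k)
      (hG₂.iterTotalGraph k) hk).trans hiff⟩

end SimpleGraph

theorem theorem3p3 {V₁ : Type u} {V₂ : Type v} [Fintype V₁] [Fintype V₂]
    (G₁ : SimpleGraph V₁) (G₂ : SimpleGraph V₂) [DecidableRel G₁.Adj] [DecidableRel G₂.Adj]
    (n₀ r₀ : ℕ) (hr₀ : 3 ≤ r₀)
    (hn₁ : Fintype.card V₁ = n₀) (hn₂ : Fintype.card V₂ = n₀)
    (hG₁ : G₁.IsRegularOfDegree r₀) (hG₂ : G₂.IsRegularOfDegree r₀)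
    (k : ℕ) (hk : 1 ≤ k) :
    (Nat.card (G₁.IterTotalVertex k) = Nat.card (G₂.IterTotalVertex k) ∧
      (G₁.iterTotalGraph k).edgeSet.ncard = (G₂.iterTotalGraph k).edgeSet.ncard) ∧
    ((G₁.iterTotalGraph k).Cospectral (G₂.iterTotalGraph k) ↔ G₁.Cospectral G₂) := by
  classical
  obtain ⟨hc, hiff⟩ := hG₁.card_eq_and_cospectral_iterTotalGraph_iff hr₀ hG₂
    (by rw [Nat.card_eq_fintype_card, Nat.card_eq_fintype_card, hn₁, hn₂]) k
  let _ := Fintype.ofFinite (G₁.IterTotalVertex k)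
  let _ := Fintype.ofFinite (G₂.IterTotalVertex k)
  exact ⟨⟨hc, SimpleGraph.IsRegularOfDegree.card_edgeSet_eq (hG₁.iterTotalGraph k)
    (hG₂.iterTotalGraph k) hc⟩, hiff⟩
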